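/- Let $G$ be a Hausdorff locally compact group with identity $e$ and a fixed left Haar measure, let $1<p<\infty$ and $\frac1p+\frac1q=1$. For a function $f$ on $G$ put $f^\vee(x)=f(x^{-1})$. Let $A_p(G)$ be the Herz algebra: the space of all functions $u=\sum_{i=1}^\infty g_i*f_i^\vee$ on $G$ with $f_i\in L^p(G)$, $g_i\in L^q(G)$ and $\sum_i\|f_i\|_p\|g_i\|_q<\infty$, with norm $\|u\|_{A_p(G)}=\inf\sum_i\|f_i\|_p\|g_i\|_q$, the infimum being over all such representations of $u$. Let $B_p(G)$ be the algebra, under pointwise multiplication, of all bounded continuous functions $u:G\to\mathbb C$ with $uv\in A_p(G)$ for every $v\in A_p(G)$, with norm $\|u\|=\sup\{\|uv\|_{A_p(G)}:\|v\|_{A_p(G)}\le 1\}$. Let $I\in B_p(G)^*$ be $I(u)=u(e)$. For $u\in B_p(G)$, $\phi\in B_p(G)^*$ and $F\in B_p(G)^{**}$ define $\phi u\in B_p(G)^*$ by $\langle \phi u,v\rangle=\langle\phi,uv\rangle$ and $uF\in B_p(G)^{**}$ by $\langle uF,\phi\rangle=\langle F,\phi u\rangle$. The set of topological invariant means on $B_p(G)^*$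 is $$TIMB_p^*(G)=\{F\in B_p(G)^{**}:\ \|F\|=F(I)=1,\ uF=u(e)F\text{ for all }u\in B_p(G)\}.$$ **Proposition.** Regard $B_p(G)$ as a subspace of $B_p(G)^{**}$ through the canonical embedding. Then $TIMB_p^*(G)\cap B_p(G)\neq\emptyset$ if and only if $G$ is discrete. In this case $TIMB_p^*(G)\cap B_p(G)=\{\chi_e\}$, where $\chi_e$ is the indicator function of $\{e\}$. -/

import Mathlib

open MeasureTheory
open scoped ENNReal

set_option linter.unusedSectionVars false

noncomputable section

namespace HerzMult

variable {G : Type*} [Group G] [TopologicalSpace G] [IsTopologicalGroup G]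
  [LocallyCompactSpace G] [T2Space G] [MeasurableSpace G] [BorelSpace G]

/-- The convolution `(g * h)(x) = ∫ g(y) h(y⁻¹x) dy` of functions on `G`. -/
def conv (μ : Measure G) (g h : G → ℂ) (x : G) : ℂ :=
  ∫ y, g y * h (y⁻¹ * x) ∂μ

/-- `f^∨(x) = f(x⁻¹)`. -/
def check (f : G → ℂ) (x : G) : ℂ := f x⁻¹

theorem conv_check (μ : Measure G) (g f : G → ℂ) (x : G) :
    conv μ g (check f) x = ∫ y, g y * f (x⁻¹ * y) ∂μ := by
  simp [conv, check]

/-- `u = ∑ gᵢ * fᵢ^∨` with `fᵢ ∈ L^p(G)`, `gᵢ ∈ L^q(G)` and `∑ ‖fᵢ‖_p ‖gᵢ‖_q < ∞`. -/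
structure IsRep (μ : Measure G) {p q : ℝ≥0∞} (f : ℕ → Lp ℂ p μ) (g : ℕ → Lp ℂ q μ)
    (u : G → ℂ) : Prop where
  summable : Summable fun i => ‖f i‖ * ‖g i‖
  hasSum : ∀ x, HasSum (fun i => conv μ (g i) (check (f i)) x) (u x)

/-- `‖u‖_{A_p(G)} = inf {∑ ‖fᵢ‖_p ‖gᵢ‖_q : u = ∑ gᵢ * fᵢ^∨}`. -/
def herzNorm (μ : Measure G) (p q : ℝ≥0∞) (u : G → ℂ) : ℝ :=
  sInf {c : ℝ | ∃ (f : ℕ → Lp ℂ p μ) (g : ℕ → Lp ℂ q μ),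
    IsRep μ f g u ∧ c = ∑' i, ‖f i‖ * ‖g i‖}

/-- There is a representation of `u` of total cost at most `c`. -/
def HasRep (μ : Measure G) (p q : ℝ≥0∞) (u : G → ℂ) (c : ℝ) : Prop :=
  ∃ (f : ℕ → Lp ℂ p μ) (g : ℕ → Lp ℂ q μ), IsRep μ f g u ∧ ∑' i, ‖f i‖ * ‖g i‖ ≤ c

section basic

variable {μ : Measure G} {p q : ℝ≥0∞}

theorem cost_nonneg (f : Lp ℂ p μ) (g : Lp ℂ q μ) : 0 ≤ ‖f‖ * ‖g‖ := by
  rw [Lp.norm_def, Lp.norm_def]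
  positivity

theorem HasRep.herzNorm_le {u : G → ℂ} {c : ℝ} (h : HasRep μ p q u c) :
    herzNorm μ p q u ≤ c := by
  obtain ⟨f, g, h1, h2⟩ := h
  refine le_trans (csInf_le ⟨0, ?_⟩ ⟨f, g, h1, rfl⟩) h2
  rintro _ ⟨f, g, -, rfl⟩
  exact tsum_nonneg fun i => cost_nonneg _ _

theorem hasRep_of_lt {u : G → ℂ} {c : ℝ}
    (h : ∃ (f : ℕ → Lp ℂ p μ) (g : ℕ → Lp ℂ q μ), IsRep μ f g u)
    (hc : herzNorm μ p q u < c) : HasRep μ p q u c := by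
  obtain ⟨f0, g0, h0⟩ := h
  obtain ⟨c', ⟨f, g, h1, h3⟩, h2⟩ := exists_lt_of_csInf_lt (by exact ⟨_, f0, g0, h0, rfl⟩) hc
  subst h3
  exact ⟨f, g, h1, h2.le⟩

theorem herzNorm_nonneg (u : G → ℂ) : 0 ≤ herzNorm μ p q u := by
  apply Real.sInf_nonneg
  rintro _ ⟨f, g, -, rfl⟩
  exact tsum_nonneg fun i => cost_nonneg _ _

theorem norm_conv_le [μ.IsMulLeftInvariant] [p.HolderConjugate q]
    (f : Lp ℂ p μ) (g : Lp ℂ q μ) (x : G) :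
    ‖conv μ g (check f) x‖ ≤ ‖f‖ * ‖g‖ := by
  have hf : MemLp (fun y => f (x⁻¹ * y)) p μ :=
    (Lp.memLp f).comp_measurePreserving (measurePreserving_mul_left μ x⁻¹)
  have hfn : eLpNorm (fun y => f (x⁻¹ * y)) p μ = eLpNorm f p μ :=
    eLpNorm_comp_measurePreserving (Lp.aestronglyMeasurable f)
      (measurePreserving_mul_left μ x⁻¹)
  have hg := Lp.memLp g
  have key : eLpNorm ((g : G → ℂ) • fun y => f (x⁻¹ * y)) 1 μ
      ≤ eLpNorm g q μ * eLpNorm (fun y => f (x⁻¹ * y)) p μ :=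
    eLpNorm_smul_le_mul_eLpNorm hf.1 hg.1
  rw [conv_check, ← toReal_enorm, mul_comm, Lp.norm_def, Lp.norm_def, ← ENNReal.toReal_mul]
  apply ENNReal.toReal_mono (ENNReal.mul_ne_top hg.2.ne (Lp.memLp f).2.ne)
  rw [← hfn]
  refine (enorm_integral_le_lintegral_enorm _).trans ?_
  rw [eLpNorm_one_eq_lintegral_enorm] at key
  exact key

theorem HasRep.norm_le [μ.IsMulLeftInvariant] [p.HolderConjugate q] {u : G → ℂ} {c : ℝ}
    (h : HasRep μ p q u c) (x : G) : ‖u x‖ ≤ c := by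
  obtain ⟨f, g, h1, h2⟩ := h
  rw [← (h1.hasSum x).tsum_eq]
  exact (tsum_of_norm_bounded h1.summable.hasSum fun i => norm_conv_le (f i) (g i) x).trans h2

theorem conv_zero_left (h : G → ℂ) (x : G) :
    conv μ ((0 : Lp ℂ q μ) : G → ℂ) h x = 0 := by
  refine integral_eq_zero_of_ae ?_
  filter_upwards [Lp.coeFn_zero ℂ q μ] with z hz
  simp only [hz, Pi.zero_apply, zero_mul]

theorem hasRep_zero : HasRep μ p q (0 : G → ℂ) 0 := by
  refine ⟨fun _ => 0, fun _ => 0, ⟨by simp [summable_zero], fun x => ?_⟩, by simp⟩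
  simp only [conv_zero_left, Pi.zero_apply]
  exact hasSum_zero

theorem HasRep.smul [p.HolderConjugate q] {u : G → ℂ} {c : ℝ}
    (h : HasRep μ p q u c) (a : ℂ) : HasRep μ p q (a • u) (‖a‖ * c) := by
  obtain ⟨f, g, h1, h2⟩ := h
  have : Fact (1 ≤ q) := ⟨ENNReal.HolderConjugate.one_le q p⟩
  have hn : ∀ i, ‖f i‖ * ‖a • g i‖ = ‖a‖ * (‖f i‖ * ‖g i‖) := fun i => by
    rw [norm_smul]; ring
  refine ⟨f, fun i => a • g i, ⟨?_, fun x => ?_⟩, ?_⟩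
  · simp_rw [hn]; exact h1.summable.mul_left _
  · have : ∀ i, conv μ ((a • g i : Lp ℂ q μ) : G → ℂ) (check (f i)) x
        = a * conv μ (g i) (check (f i)) x := by
      intro i
      rw [conv, conv, ← integral_const_mul]
      refine integral_congr_ae ?_
      filter_upwards [Lp.coeFn_smul a (g i)] with z hz
      simp [hz, mul_assoc]
    simp_rw [this]
    exact (h1.hasSum x).mul_left a
  · simp_rw [hn]
    rw [tsum_mul_left]
    gcongr

/-- Countable sums of representable functions are representable. -/
theorem HasRep.sum [μ.IsMulLeftInvariant] [p.HolderConjugate q] {u : ℕ → G → ℂ} {c : ℕ → ℝ}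
    (h : ∀ n, HasRep μ p q (u n) (c n)) (hc : Summable c) {U : G → ℂ}
    (hU : ∀ x, HasSum (fun n => u n x) (U x)) : HasRep μ p q U (∑' n, c n) := by
  choose f g h1 h2 using h
  have hs : Summable fun i : ℕ × ℕ => ‖f i.1 i.2‖ * ‖g i.1 i.2‖ := by
    rw [summable_prod_of_nonneg (fun i => cost_nonneg _ _)]
    exact ⟨fun n => (h1 n).summable,
      Summable.of_nonneg_of_le (fun n => tsum_nonneg fun i => cost_nonneg _ _) h2 hc⟩
  obtain ⟨e⟩ : Nonempty (ℕ ≃ ℕ × ℕ) := ⟨Nat.pairEquiv.symm⟩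
  refine ⟨fun k => f (e k).1 (e k).2, fun k => g (e k).1 (e k).2, ⟨?_, fun x => ?_⟩, ?_⟩
  · exact hs.comp_injective e.injective
  · have hsx : Summable fun i : ℕ × ℕ => conv μ (g i.1 i.2) (check (f i.1 i.2)) x :=
      Summable.of_norm_bounded hs fun i => norm_conv_le _ _ x
    have h3 := hsx.hasSum.prod_fiberwise fun n => (h1 n).hasSum x
    rw [(hU x).unique h3]
    have h4 := (Equiv.hasSum_iff e (f := fun i : ℕ × ℕ => conv μ (g i.1 i.2) (check (f i.1 i.2)) x)).2
      hsx.hasSum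
    exact h4
  · rw [Equiv.tsum_eq e (fun i : ℕ × ℕ => ‖f i.1 i.2‖ * ‖g i.1 i.2‖), hs.tsum_prod]
    exact Summable.tsum_le_tsum h2
      (Summable.of_nonneg_of_le (fun n => tsum_nonneg fun i => cost_nonneg _ _) h2 hc) hc

theorem HasRep.add [μ.IsMulLeftInvariant] [p.HolderConjugate q] {u v : G → ℂ} {c d : ℝ}
    (hu : HasRep μ p q u c) (hv : HasRep μ p q v d) : HasRep μ p q (u + v) (c + d) := by
  let w : ℕ → G → ℂ := fun n => if n = 0 then u else if n = 1 then v else 0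
  let e : ℕ → ℝ := fun n => if n = 0 then c else if n = 1 then d else 0
  have hb : ∀ b, b ∉ Finset.range 2 → b ≠ 0 ∧ b ≠ 1 := fun b hb => by
    simp at hb; omega
  have he : HasSum e (∑ b ∈ Finset.range 2, e b) :=
    hasSum_sum_of_ne_finset_zero fun b h => by simp [e, hb b h]
  have he' : ∑ b ∈ Finset.range 2, e b = c + d := by simp [Finset.sum_range_succ, e]
  rw [← he', ← he.tsum_eq]
  refine HasRep.sum (u := w) (fun n => ?_) he.summable (fun x => ?_)
  · by_cases h0 : n = 0
    · simpa [w, e, h0] using hu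
    · by_cases h1 : n = 1
      · simpa [w, e, h1] using hv
      · simpa [w, e, h0, h1] using hasRep_zero
  · have hw : HasSum (fun n => w n x) (∑ b ∈ Finset.range 2, w b x) :=
      hasSum_sum_of_ne_finset_zero fun b h => by simp [w, hb b h]
    have hw' : ∑ b ∈ Finset.range 2, w b x = (u + v) x := by simp [Finset.sum_range_succ, w]
    rwa [hw'] at hw

theorem hasRep_single (f : Lp ℂ p μ) (g : Lp ℂ q μ) :
    HasRep μ p q (conv μ g (check f)) (‖f‖ * ‖g‖) := by
  have hn : HasSum (fun i : ℕ => ‖f‖ * ‖if i = 0 then g else 0‖) (‖f‖ * ‖g‖) := by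
    have h := hasSum_single (f := fun i : ℕ => ‖f‖ * ‖if i = 0 then g else 0‖) 0
      fun i hi => by simp [hi]
    simpa using h
  refine ⟨fun _ => f, fun i => if i = 0 then g else 0, ⟨hn.summable, fun x => ?_⟩, hn.tsum_eq.le⟩
  have h := hasSum_single
    (f := fun i : ℕ => conv μ ((if i = 0 then g else 0 : Lp ℂ q μ) : G → ℂ) (check f) x) 0
      fun i hi => by simp only [hi, if_false, conv_zero_left]
  simpa using h

/-- At every point there is a function in the unit ball of `A_p(G)` taking the value `1`. -/
theorem exists_peak [μ.IsHaarMeasure] [p.HolderConjugate q] (x : G) :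
    ∃ v : G → ℂ, HasRep μ p q v 1 ∧ v x = 1 := by
  obtain ⟨K, hKc, hK⟩ := exists_compact_mem_nhds (1 : G)
  have hKm : MeasurableSet K := hKc.isClosed.measurableSet
  have hKt : μ K ≠ ∞ := hKc.measure_lt_top.ne
  have hK0 : μ K ≠ 0 := (Measure.measure_pos_of_mem_nhds μ hK).ne'
  have hmp := measurePreserving_mul_left μ x⁻¹
  let S : Set G := (fun y => x⁻¹ * y) ⁻¹' K
  have hSm : MeasurableSet S := hmp.measurable hKm
  have hS : μ S = μ K := measure_preimage_mul μ x⁻¹ K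
  let m : ℝ := μ.real K
  have hm : 0 < m := ENNReal.toReal_pos hK0 hKt
  let f : Lp ℂ p μ := indicatorConstLp p hKm hKt 1
  let g : Lp ℂ q μ := indicatorConstLp q hSm (hS ▸ hKt) (m⁻¹ : ℂ)
  have hf : ‖f‖ = m ^ (1 / p.toReal) := by
    rw [norm_indicatorConstLp' (ENNReal.HolderConjugate.pos p q).ne' hK0]
    simp [m]
  have hg : ‖g‖ = m⁻¹ * m ^ (1 / q.toReal) := by
    rw [norm_indicatorConstLp' (ENNReal.HolderConjugate.pos q p).ne' (hS ▸ hK0)]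
    simp [m, measureReal_def, hS]
  have hpq : 1 / p.toReal + 1 / q.toReal = 1 := by
    have h := ENNReal.HolderConjugate.inv_add_inv_eq_one p q
    have h' := congrArg ENNReal.toReal h
    have hp := ENNReal.inv_ne_top.2 (ENNReal.HolderConjugate.pos p q).ne'
    have hq := ENNReal.inv_ne_top.2 (ENNReal.HolderConjugate.pos q p).ne'
    rw [ENNReal.toReal_add hp hq] at h'
    simpa using h'
  have hc : ‖f‖ * ‖g‖ = 1 := by
    rw [hf, hg, mul_left_comm, ← Real.rpow_add hm, hpq, Real.rpow_one, inv_mul_cancel₀ hm.ne']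
  refine ⟨conv μ g (check f), hc ▸ hasRep_single f g, ?_⟩
  have h1 : (g : G → ℂ) =ᵐ[μ] S.indicator fun _ => (m⁻¹ : ℂ) := indicatorConstLp_coeFn
  have h2 : (f : G → ℂ) =ᵐ[μ] K.indicator fun _ => (1 : ℂ) := indicatorConstLp_coeFn
  have h3 := hmp.quasiMeasurePreserving.ae_eq_comp h2
  rw [conv_check]
  have h4 : (fun y => (g : G → ℂ) y * (f : G → ℂ) (x⁻¹ * y)) =ᵐ[μ]
      S.indicator fun _ => (m⁻¹ : ℂ) := by
    filter_upwards [h1, h3] with y hy1 hy3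
    simp only [Function.comp] at hy3
    rw [hy1, hy3]
    by_cases hy : y ∈ S
    · have : x⁻¹ * y ∈ K := hy
      simp [hy, this]
    · simp [hy]
  rw [integral_congr_ae h4, integral_indicator hSm, setIntegral_const, measureReal_def, hS]
  change (m : ℝ) • (m⁻¹ : ℂ) = 1
  rw [Complex.real_smul, mul_inv_cancel₀]
  exact_mod_cast hm.ne'

end basic

section algebras

variable (μ : Measure G) (p q : ℝ≥0∞) [μ.IsHaarMeasure] [p.HolderConjugate q]

/-- The functions of the form `u = ∑ gᵢ * fᵢ^∨` with `fᵢ ∈ L^p(G)`, `gᵢ ∈ L^q(G)` and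
`∑ ‖fᵢ‖_p ‖gᵢ‖_q < ∞`. -/
def herzSubmodule : Submodule ℂ (G → ℂ) where
  carrier := {u | ∃ (f : ℕ → Lp ℂ p μ) (g : ℕ → Lp ℂ q μ), IsRep μ f g u}
  add_mem' := by
    rintro u v ⟨f, g, h⟩ ⟨f', g', h'⟩
    obtain ⟨f'', g'', h'', -⟩ :=
      HasRep.add ⟨f, g, h, le_rfl⟩ (⟨f', g', h', le_rfl⟩ : HasRep μ p q v _)
    exact ⟨f'', g'', h''⟩
  zero_mem' := by
    obtain ⟨f, g, h, -⟩ := hasRep_zero (μ := μ) (p := p) (q := q)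
    exact ⟨f, g, h⟩
  smul_mem' := by
    rintro a u ⟨f, g, h⟩
    obtain ⟨f', g', h', -⟩ := HasRep.smul (⟨f, g, h, le_rfl⟩ : HasRep μ p q u _) a
    exact ⟨f', g', h'⟩

/-- The Herz algebra `A_p(G)`, where `1/p + 1/q = 1`. -/
def HerzAlgebra : Type _ := herzSubmodule μ p q

namespace HerzAlgebra

instance : AddCommGroup (HerzAlgebra μ p q) := inferInstanceAs (AddCommGroup (herzSubmodule μ p q))

instance : Module ℂ (HerzAlgebra μ p q) := inferInstanceAs (Module ℂ (herzSubmodule μ p q))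

instance : FunLike (HerzAlgebra μ p q) G ℂ where
  coe u := u.1
  coe_injective := Subtype.val_injective

instance : Norm (HerzAlgebra μ p q) := ⟨fun u => herzNorm μ p q u⟩

variable {μ p q}

theorem add_apply (u v : HerzAlgebra μ p q) (x : G) : (u + v) x = u x + v x := rfl

theorem sub_apply (u v : HerzAlgebra μ p q) (x : G) : (u - v) x = u x - v x := rfl

theorem zero_apply (x : G) : (0 : HerzAlgebra μ p q) x = 0 := rfl

theorem hasRep (u : HerzAlgebra μ p q) {c : ℝ} (hc : ‖u‖ < c) : HasRep μ p q u c :=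
  hasRep_of_lt u.2 hc

theorem norm_le {u : HerzAlgebra μ p q} {c : ℝ} (h : HasRep μ p q u c) : ‖u‖ ≤ c :=
  h.herzNorm_le

theorem norm_apply_le (u : HerzAlgebra μ p q) (x : G) : ‖u x‖ ≤ ‖u‖ :=
  le_of_forall_gt_imp_ge_of_dense fun _ hc => (u.hasRep hc).norm_le x

theorem norm_smul_le' (a : ℂ) (u : HerzAlgebra μ p q) : ‖a • u‖ ≤ ‖a‖ * ‖u‖ := by
  refine le_of_forall_pos_le_add fun ε hε => ?_
  have h := norm_le (u := a • u)
    ((u.hasRep (c := ‖u‖ + ε / (‖a‖ + 1)) (by linarith [show 0 < ε / (‖a‖ + 1) by positivity])).smul a)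
  refine h.trans ?_
  rw [mul_add]
  gcongr
  rw [mul_div_assoc', div_le_iff₀ (by positivity)]
  nlinarith [norm_nonneg a]

variable (μ p q) in
theorem core : NormedSpace.Core ℂ (HerzAlgebra μ p q) where
  norm_nonneg u := herzNorm_nonneg _
  norm_smul a u := by
    refine le_antisymm (norm_smul_le' a u) ?_
    by_cases ha : a = 0
    · subst ha
      simp only [norm_zero, zero_mul]
      exact herzNorm_nonneg _
    · have h := norm_smul_le' a⁻¹ (a • u)
      rw [smul_smul, inv_mul_cancel₀ ha, one_smul, norm_inv] at h
      have hp : 0 < ‖a‖ := norm_pos_iff.2 ha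
      calc ‖a‖ * ‖u‖ ≤ ‖a‖ * (‖a‖⁻¹ * ‖a • u‖) := by gcongr
        _ = ‖a • u‖ := by field_simp
  norm_triangle u v := by
    refine le_of_forall_pos_le_add fun ε hε => ?_
    have h := norm_le (u := u + v) ((u.hasRep (c := ‖u‖ + ε / 2) (by linarith)).add
      (v.hasRep (c := ‖v‖ + ε / 2) (by linarith)))
    linarith
  norm_eq_zero_iff u := by
    constructor
    · intro h
      refine DFunLike.ext _ _ fun x => ?_
      have := norm_apply_le u x
      rw [h] at this
      rw [zero_apply]
      exact norm_le_zero_iff.1 this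
    · rintro rfl
      exact le_antisymm (norm_le hasRep_zero) (herzNorm_nonneg _)

instance : NormedAddCommGroup (HerzAlgebra μ p q) := NormedAddCommGroup.ofCore (core μ p q)

instance : NormedSpace ℂ (HerzAlgebra μ p q) := NormedSpace.ofCore (core μ p q)

theorem sum_apply (u : ℕ → HerzAlgebra μ p q) (n : ℕ) (x : G) :
    (∑ i ∈ Finset.range n, u i) x = ∑ i ∈ Finset.range n, u i x := by
  induction n with
  | zero => simp [zero_apply]
  | succ n ih => rw [Finset.sum_range_succ, Finset.sum_range_succ, add_apply, ih]

instance : CompleteSpace (HerzAlgebra μ p q) := by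
  refine NormedAddCommGroup.completeSpace_of_summable_imp_tendsto fun u hu => ?_
  let c : ℕ → ℝ := fun n => ‖u n‖ + (1 / 2) ^ n
  have hc : Summable c := hu.add summable_geometric_two
  have hrep : ∀ n, HasRep μ p q (u n) (c n) := fun n =>
    (u n).hasRep (by simp only [c]; linarith [show (0 : ℝ) < (1 / 2) ^ n by positivity])
  have hx : ∀ x, Summable fun n => u n x := fun x =>
    Summable.of_norm_bounded hu fun n => norm_apply_le (u n) x
  obtain ⟨f, g, hfg, -⟩ := HasRep.sum hrep hc fun x => (hx x).hasSum
  let U : HerzAlgebra μ p q := ⟨_, f, g, hfg⟩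
  have hU : ∀ x, HasSum (fun n => u n x) (U x) := fun x => (hx x).hasSum
  refine ⟨U, tendsto_iff_norm_sub_tendsto_zero.2 ?_⟩
  refine squeeze_zero (fun n => norm_nonneg _) (fun n => ?_) (tendsto_sum_nat_add c)
  rw [norm_sub_rev]
  refine norm_le (HasRep.sum (fun k => hrep (k + n)) ((summable_nat_add_iff n).2 hc) fun x => ?_)
  rw [sub_apply, sum_apply]
  exact (hasSum_nat_add_iff' n).2 (hU x)

end HerzAlgebra

/-- The bounded continuous functions `u` on `G` with `uv ∈ A_p(G)` for all `v ∈ A_p(G)`. -/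
def multiplierSubalgebra : Subalgebra ℂ (G → ℂ) where
  carrier := {u | Continuous u ∧ (∃ C : ℝ, ∀ x, ‖u x‖ ≤ C) ∧
    ∀ v ∈ herzSubmodule μ p q, u * v ∈ herzSubmodule μ p q}
  mul_mem' := by
    rintro u v ⟨hu, ⟨C, hC⟩, hu'⟩ ⟨hv, ⟨D, hD⟩, hv'⟩
    refine ⟨hu.mul hv, ⟨C * D, fun x => ?_⟩, fun w hw => ?_⟩
    · rw [Pi.mul_apply, norm_mul]
      exact mul_le_mul (hC x) (hD x) (norm_nonneg _) ((norm_nonneg _).trans (hC x))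
    · rw [mul_assoc]
      exact hu' _ (hv' _ hw)
  add_mem' := by
    rintro u v ⟨hu, ⟨C, hC⟩, hu'⟩ ⟨hv, ⟨D, hD⟩, hv'⟩
    refine ⟨hu.add hv, ⟨C + D, fun x => (norm_add_le _ _).trans (add_le_add (hC x) (hD x))⟩,
      fun w hw => ?_⟩
    rw [add_mul]
    exact add_mem (hu' _ hw) (hv' _ hw)
  algebraMap_mem' a := by
    refine ⟨continuous_const, ⟨‖a‖, fun x => le_rfl⟩, fun w hw => ?_⟩
    rw [← Algebra.smul_def]
    exact Submodule.smul_mem _ a hw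

/-- The algebra `B_p(G)` of pointwise multipliers of `A_p(G)`, where `1/p + 1/q = 1`. -/
def Multiplier : Type _ := multiplierSubalgebra μ p q

namespace Multiplier

instance : CommRing (Multiplier μ p q) := inferInstanceAs (CommRing (multiplierSubalgebra μ p q))

instance : Algebra ℂ (Multiplier μ p q) :=
  inferInstanceAs (Algebra ℂ (multiplierSubalgebra μ p q))

instance : FunLike (Multiplier μ p q) G ℂ where
  coe u := u.1
  coe_injective := Subtype.val_injective

variable {μ p q}

theorem mul_apply (u v : Multiplier μ p q) (x : G) : (u * v) x = u x * v x := rfl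

theorem add_apply (u v : Multiplier μ p q) (x : G) : (u + v) x = u x + v x := rfl

theorem smul_apply (a : ℂ) (u : Multiplier μ p q) (x : G) : (a • u) x = a * u x := rfl

theorem zero_apply (x : G) : (0 : Multiplier μ p q) x = 0 := rfl

/-- The multiplication operator `v ↦ uv` on `A_p(G)`. -/
def mulMap (u : Multiplier μ p q) : HerzAlgebra μ p q →ₗ[ℂ] HerzAlgebra μ p q where
  toFun v := ⟨fun x => u x * v x, u.2.2.2 v v.2⟩
  map_add' v w := DFunLike.ext _ _ fun x => mul_add (u x) (v x) (w x)
  map_smul' a v := DFunLike.ext _ _ fun x => mul_left_comm (u x) a (v x)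

theorem mulMap_apply (u : Multiplier μ p q) (v : HerzAlgebra μ p q) (x : G) :
    mulMap u v x = u x * v x := rfl

/-- `‖u‖ = sup {‖uv‖_{A_p(G)} : ‖v‖_{A_p(G)} ≤ 1}`. -/
instance : Norm (Multiplier μ p q) :=
  ⟨fun u => sSup {r : ℝ | ∃ v : HerzAlgebra μ p q, ‖v‖ ≤ 1 ∧ r = ‖mulMap u v‖}⟩

theorem continuous_mulMap (u : Multiplier μ p q) : Continuous (mulMap u) := by
  refine LinearMap.continuous_of_seq_closed_graph _ fun v a b hv hb => ?_
  have hpt : ∀ (w : ℕ → HerzAlgebra μ p q) (c : HerzAlgebra μ p q) (x : G),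
      Filter.Tendsto w Filter.atTop (nhds c) →
      Filter.Tendsto (fun n => w n x) Filter.atTop (nhds (c x)) := fun w c x h =>
    tendsto_iff_norm_sub_tendsto_zero.2 <| squeeze_zero (fun n => norm_nonneg _)
      (fun n => HerzAlgebra.norm_apply_le (w n - c) x) (tendsto_iff_norm_sub_tendsto_zero.1 h)
  refine DFunLike.ext _ _ fun x => ?_
  exact tendsto_nhds_unique (hpt _ _ x hb) ((hpt _ _ x hv).const_mul (u x))

/-- The multiplication operator `v ↦ uv`, as a bounded operator on `A_p(G)`. -/
def mulCLM (u : Multiplier μ p q) : HerzAlgebra μ p q →L[ℂ] HerzAlgebra μ p q :=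
  ⟨mulMap u, continuous_mulMap u⟩

theorem norm_eq (u : Multiplier μ p q) : ‖u‖ = ‖mulCLM u‖ := by
  rw [← ContinuousLinearMap.sSup_unitClosedBall_eq_norm]
  change sSup _ = _
  congr 1
  ext r
  constructor
  · rintro ⟨v, hv, rfl⟩
    exact ⟨v, by simpa using hv, rfl⟩
  · rintro ⟨v, hv, rfl⟩
    exact ⟨v, by simpa using hv, rfl⟩

theorem norm_apply_le (u : Multiplier μ p q) (x : G) : ‖u x‖ ≤ ‖u‖ := by
  obtain ⟨v, ⟨f, g, h, hc⟩, hv⟩ := exists_peak (μ := μ) (p := p) (q := q) x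
  let w : HerzAlgebra μ p q := ⟨v, f, g, h⟩
  have hw : ‖w‖ ≤ 1 := HerzAlgebra.norm_le ⟨f, g, h, hc⟩
  have hwx : w x = 1 := hv
  calc ‖u x‖ = ‖mulCLM u w x‖ := by
        change _ = ‖u x * w x‖
        rw [hwx, mul_one]
    _ ≤ ‖mulCLM u w‖ := HerzAlgebra.norm_apply_le _ x
    _ ≤ ‖mulCLM u‖ := (mulCLM u).unit_le_opNorm w hw
    _ = ‖u‖ := (norm_eq u).symm

variable (μ p q) in
theorem core : NormedSpace.Core ℂ (Multiplier μ p q) where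
  norm_nonneg u := by rw [norm_eq]; exact norm_nonneg _
  norm_smul a u := by
    rw [norm_eq, norm_eq, ← norm_smul]
    congr 1
    ext v
    exact DFunLike.ext _ _ fun x => mul_assoc a (u x) (v x)
  norm_triangle u v := by
    rw [norm_eq, norm_eq, norm_eq]
    refine le_trans (le_of_eq ?_) (norm_add_le _ _)
    congr 1
    ext w
    exact DFunLike.ext _ _ fun x => add_mul (u x) (v x) (w x)
  norm_eq_zero_iff u := by
    constructor
    · intro h
      refine DFunLike.ext _ _ fun x => ?_
      have := norm_apply_le u x
      rw [h] at this
      rw [zero_apply]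
      exact norm_le_zero_iff.1 this
    · rintro rfl
      rw [norm_eq, norm_eq_zero]
      ext v
      exact DFunLike.ext _ _ fun x => zero_mul (v x)

instance : NormedAddCommGroup (Multiplier μ p q) := NormedAddCommGroup.ofCore (core μ p q)

instance : NormedCommRing (Multiplier μ p q) where
  __ := (inferInstance : NormedAddCommGroup (Multiplier μ p q))
  __ := (inferInstance : CommRing (Multiplier μ p q))
  norm_mul_le u v := by
    rw [norm_eq, norm_eq, norm_eq]
    refine le_trans (le_of_eq ?_) (ContinuousLinearMap.opNorm_comp_le (mulCLM u) (mulCLM v))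
    congr 1
    ext w
    exact DFunLike.ext _ _ fun x => mul_assoc (u x) (v x) (w x)

instance : NormedAlgebra ℂ (Multiplier μ p q) where
  norm_smul_le a u := ((core μ p q).norm_smul a u).le

variable (μ p q) in
/-- The functional `I(u) = u(e)` on `B_p(G)`. -/
def evalOne : StrongDual ℂ (Multiplier μ p q) :=
  LinearMap.mkContinuous
    { toFun := fun u => u 1
      map_add' := fun u v => add_apply u v 1
      map_smul' := fun a u => smul_apply a u 1 } 1
    fun u => by rw [one_mul]; exact norm_apply_le u 1

/-- The action of `B_p(G)` on its dual, `⟨φu, v⟩ = ⟨φ, uv⟩`. -/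
def dualAct (φ : StrongDual ℂ (Multiplier μ p q)) (u : Multiplier μ p q) :
    StrongDual ℂ (Multiplier μ p q) :=
  φ.comp (ContinuousLinearMap.mul ℂ (Multiplier μ p q) u)

/-- The adjoint action `⟨uF, φ⟩ = ⟨F, φu⟩` of `B_p(G)` on its bidual. -/
def bidualAct (u : Multiplier μ p q) (F : StrongDual ℂ (StrongDual ℂ (Multiplier μ p q))) :
    StrongDual ℂ (StrongDual ℂ (Multiplier μ p q)) :=
  F.comp ((ContinuousLinearMap.mul ℂ (Multiplier μ p q) u).precomp ℂ)

theorem dualAct_apply (φ : StrongDual ℂ (Multiplier μ p q)) (u v : Multiplier μ p q) :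
    dualAct φ u v = φ (u * v) := rfl

theorem bidualAct_apply (u : Multiplier μ p q)
    (F : StrongDual ℂ (StrongDual ℂ (Multiplier μ p q))) (φ : StrongDual ℂ (Multiplier μ p q)) :
    bidualAct u F φ = F (dualAct φ u) := rfl

variable (μ p q) in
/-- The means on `B_p(G)^*`: functionals `F` with `‖F‖ = F(I) = 1`. -/
def means : Set (StrongDual ℂ (StrongDual ℂ (Multiplier μ p q))) :=
  {F | ‖F‖ = 1 ∧ F (evalOne μ p q) = 1}

variable (μ p q) in
/-- The topological invariant means on `B_p(G)^*`: means `F` with `uF = u(e)F` for all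
`u ∈ B_p(G)`. -/
def topInvMeans : Set (StrongDual ℂ (StrongDual ℂ (Multiplier μ p q))) :=
  {F | F ∈ means μ p q ∧ ∀ u : Multiplier μ p q, bidualAct u F = u 1 • F}

end Multiplier

end algebras

end HerzMult

end

/-! An element u of B_p(G), seen in the bidual, is a topological invariant mean exactly when ‖u‖ =
u(e) = 1 and vu = v(e)u for every v in B_p(G), because functionals separate the points of B_p(G). At
a point x this identity reads v(x)u(x) = v(e)u(x), so u(x) = 0 as soon as some v has v(x) ≠ v(e).
Hence u = χ_e, and since u is continuous, {e} is open and G is discrete. Conversely, if G is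
discrete then χ_e is a multiple of χ_e * χ_e^∨ and has norm at most 1 in A_p(G). Multiplication by
it is v ↦ v(e)χ_e, from which the norm and the invariance follow.

The work lies in producing enough multipliers to separate e from x. The full theorem that A_p(G) is
an algebra is not needed: the functions h * h^∨ with h in C_c(G) suffice. The product of h * h^∨ and
g * f^∨ is the integral over r of G_r * F_r^∨, where F_r(s) = f(s)h(sr) and G_r(s) = g(s)h(sr)
(`integral_integral_slice_mul_slice`). For f, g in C_c(G) this is a Bochner integral in the Banach
space A_p(G). Hölder's inequality in r bounds its norm by ‖h‖_p ‖h‖_q ‖f‖_p ‖g‖_q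
(`exists_apply_eq_of_hasCompactSupport`). Density of C_c(G) in L^p and L^q, followed by summation of
series, extends this to all of A_p(G) (`conv_check_self_mul_mem`). -/

noncomputable section

/-! ### Density of compactly supported continuous functions in L^p -/

namespace HerzMult

open Filter Topology

/-- Functions in `L^p`, `p < ∞`, on a locally compact Hausdorff space are approximated by compactly
supported continuous functions. Unlike `MemLp.exists_hasCompactSupport_eLpNorm_sub_le`, normality
of the space is not required. -/
theorem exists_hasCompactSupport_eLpNorm_sub_le {X : Type*} [TopologicalSpace X] [T2Space X]
    [LocallyCompactSpace X] [MeasurableSpace X] [BorelSpace X] {ν : Measure X} [ν.Regular]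
    {p : ℝ≥0∞} (hp : p ≠ ∞) {f : X → ℂ} (hf : MemLp f p ν) {ε : ℝ≥0∞} (hε : ε ≠ 0) :
    ∃ g : X → ℂ, eLpNorm (f - g) p ν ≤ ε ∧ Continuous g ∧ HasCompactSupport g := by
  refine hf.induction_dense hp _ ?_ ?_ ?_ hε
  · intro c t ht htν ε hε
    obtain ⟨δ, δpos, hδ⟩ := exists_Lp_half ℂ ν p hε
    obtain ⟨η, ηpos, hη⟩ := exists_eLpNorm_indicator_le hp c δpos.ne' (μ := ν)
    have hη' : (η : ℝ≥0∞) ≠ 0 := (ENNReal.coe_pos.2 ηpos).ne'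
    -- Inner regularity gives a compact s inside t, outer regularity then gives an open V around s.
    -- Both exceed or miss by measure less than η, which costs at most δ in L^p.
    obtain ⟨s, st, s_compact, s_closed, νs⟩ := ht.exists_isCompact_isClosed_sdiff_lt htν.ne hη'
    have I1 : eLpNorm ((s.indicator fun _ => c) - t.indicator fun _ => c) p ν ≤ δ := by
      rw [← eLpNorm_neg, neg_sub, ← Set.indicator_sdiff st]
      exact hη _ νs.le
    obtain ⟨V, sV, V_open, -, hV⟩ :=
      s_closed.measurableSet.exists_isOpen_sdiff_lt (s_compact.measure_lt_top (μ := ν)).ne hη'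
    obtain ⟨g, hgs, hgV, hg, hg01⟩ := exists_continuous_one_zero_of_isCompact s_compact
      V_open.isClosed_compl (Set.disjoint_compl_right_iff_subset.2 sV)
    let f : X → ℂ := fun x => g x • c
    have f_cont : Continuous f := by fun_prop
    -- The two functions differ only on V \ s, and there by at most ‖c‖.
    have I2 : eLpNorm (f - s.indicator fun _ => c) p ν ≤ δ := by
      refine (eLpNorm_mono fun x => ?_).trans (hη (V \ s) hV.le)
      by_cases hs : x ∈ s
      · simp [f, hs, hgs hs]
      · by_cases hv : x ∈ V
        · have h01 := hg01 x
          simpa [f, hs, hv, abs_of_nonneg h01.1] using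
            mul_le_of_le_one_left (norm_nonneg c) h01.2
        · simp [f, hs, hgV hv]
    refine ⟨f, ?_, f_cont, hg.smul_right⟩
    have hm : ∀ u : Set X, MeasurableSet u →
        AEStronglyMeasurable (u.indicator fun _ => c) ν :=
      fun u hu => aestronglyMeasurable_const.indicator hu
    have := (hδ _ _ (f_cont.aestronglyMeasurable.sub (hm s s_closed.measurableSet))
      ((hm s s_closed.measurableSet).sub (hm t ht)) I2 I1).le
    rwa [sub_add_sub_cancel] at this
  · rintro f g ⟨hf, hf'⟩ ⟨hg, hg'⟩
    exact ⟨hf.add hg, hf'.add hg'⟩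
  · rintro f ⟨hf, -⟩
    exact hf.aestronglyMeasurable

/-- The classes in `L^p` of the compactly supported continuous functions. -/
def compactlySupportedLp {X : Type*} [TopologicalSpace X] [MeasurableSpace X] (ν : Measure X)
    (p : ℝ≥0∞) : AddSubgroup (Lp ℂ p ν) where
  carrier := {φ | ∃ f : X → ℂ, Continuous f ∧ HasCompactSupport f ∧ φ =ᵐ[ν] f}
  add_mem' := by
    rintro φ ψ ⟨f, hf, hf', h⟩ ⟨g, hg, hg', h'⟩
    exact ⟨f + g, hf.add hg, hf'.add hg', (Lp.coeFn_add φ ψ).trans (h.add h')⟩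
  zero_mem' := ⟨0, continuous_zero, HasCompactSupport.zero, Lp.coeFn_zero _ _ _⟩
  neg_mem' := by
    rintro φ ⟨f, hf, hf', h⟩
    exact ⟨-f, hf.neg, hf'.neg, (Lp.coeFn_neg φ).trans h.neg⟩

theorem dense_compactlySupportedLp {X : Type*} [TopologicalSpace X] [T2Space X]
    [LocallyCompactSpace X] [MeasurableSpace X] [BorelSpace X] (ν : Measure X) [ν.Regular]
    {p : ℝ≥0∞} [Fact (1 ≤ p)] (hp : p ≠ ∞) :
    Dense (compactlySupportedLp ν p : Set (Lp ℂ p ν)) := by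
  intro φ
  refine EMetric.mem_closure_iff.2 fun ε hε => ?_
  obtain ⟨δ, hδ, hδε⟩ := exists_between hε
  obtain ⟨f, h, hf, hf'⟩ := exists_hasCompactSupport_eLpNorm_sub_le hp (Lp.memLp φ) hδ.ne'
  have hm : MemLp f p ν := hf.memLp_of_hasCompactSupport hf'
  refine ⟨hm.toLp f, ⟨f, hf, hf', hm.coeFn_toLp⟩, lt_of_le_of_lt ?_ hδε⟩
  rw [Lp.edist_def]
  refine le_trans (le_of_eq (eLpNorm_congr_ae ?_)) h
  exact EventuallyEq.rfl.sub hm.coeFn_toLp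

/-! ### Point evaluations and the bilinear map (f, g) ↦ g * f^∨ into A_p(G) -/

variable {G : Type*} [Group G] [TopologicalSpace G] [IsTopologicalGroup G]
  [LocallyCompactSpace G] [T2Space G] [MeasurableSpace G] [BorelSpace G]
  {μ : Measure G} {p q : ℝ≥0∞} [μ.IsHaarMeasure] [p.HolderConjugate q]

namespace HerzAlgebra

theorem smul_apply (a : ℂ) (u : HerzAlgebra μ p q) (x : G) : (a • u) x = a * u x := rfl

variable (μ p q) in
/-- Evaluation at a point, as a bounded functional on `A_p(G)`. -/
def eval (x : G) : HerzAlgebra μ p q →L[ℂ] ℂ :=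
  LinearMap.mkContinuous
    { toFun := fun u => u x
      map_add' := fun u v => add_apply u v x
      map_smul' := fun a u => smul_apply a u x } 1
    fun u => by rw [one_mul]; exact norm_apply_le u x

theorem eval_apply (x : G) (u : HerzAlgebra μ p q) : eval μ p q x u = u x := rfl

/-- The function `g * f^∨`, as an element of `A_p(G)`. -/
def single (f : Lp ℂ p μ) (g : Lp ℂ q μ) : HerzAlgebra μ p q :=
  ⟨conv μ g (check f), by
    obtain ⟨f', g', h, -⟩ := hasRep_single f g
    exact ⟨f', g', h⟩⟩

theorem single_apply (f : Lp ℂ p μ) (g : Lp ℂ q μ) (x : G) :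
    single f g x = ∫ y, g y * f (x⁻¹ * y) ∂μ := conv_check μ g f x

theorem norm_single_le (f : Lp ℂ p μ) (g : Lp ℂ q μ) : ‖single f g‖ ≤ ‖f‖ * ‖g‖ :=
  norm_le (hasRep_single f g)

theorem integrable_single (f : Lp ℂ p μ) (g : Lp ℂ q μ) (x : G) :
    Integrable (fun y => g y * f (x⁻¹ * y)) μ :=
  (Lp.memLp g).integrable_mul
    ((Lp.memLp f).comp_measurePreserving (measurePreserving_mul_left μ x⁻¹))

variable (μ p q) in
/-- The bounded bilinear map `(f, g) ↦ g * f^∨` from `L^p × L^q` to `A_p(G)`. -/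
def singleBilin [Fact (1 ≤ p)] [Fact (1 ≤ q)] :
    Lp ℂ p μ →L[ℂ] Lp ℂ q μ →L[ℂ] HerzAlgebra μ p q :=
  LinearMap.mkContinuous₂
    (LinearMap.mk₂ ℂ single
      (fun f f' g => DFunLike.ext _ _ fun x => by
        rw [add_apply, single_apply, single_apply, single_apply,
          ← integral_add (integrable_single f g x) (integrable_single f' g x)]
        refine integral_congr_ae ?_
        filter_upwards [(measurePreserving_mul_left μ x⁻¹).quasiMeasurePreserving.ae
          (Lp.coeFn_add f f')] with y hy
        rw [hy, Pi.add_apply, mul_add])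
      (fun a f g => DFunLike.ext _ _ fun x => by
        rw [smul_apply, single_apply, single_apply, ← integral_const_mul]
        refine integral_congr_ae ?_
        filter_upwards [(measurePreserving_mul_left μ x⁻¹).quasiMeasurePreserving.ae
          (Lp.coeFn_smul a f)] with y hy
        rw [hy, Pi.smul_apply, smul_eq_mul, mul_left_comm])
      (fun f g g' => DFunLike.ext _ _ fun x => by
        rw [add_apply, single_apply, single_apply, single_apply,
          ← integral_add (integrable_single f g x) (integrable_single f g' x)]
        refine integral_congr_ae ?_
        filter_upwards [Lp.coeFn_add g g'] with y hy
        rw [hy, Pi.add_apply, add_mul])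
      (fun a f g => DFunLike.ext _ _ fun x => by
        rw [smul_apply, single_apply, single_apply, ← integral_const_mul]
        refine integral_congr_ae ?_
        filter_upwards [Lp.coeFn_smul a g] with y hy
        rw [hy, Pi.smul_apply, smul_eq_mul, mul_assoc]))
    1 fun f g => by rw [one_mul]; exact norm_single_le f g

/-- If a family of bounded functionals `ℓ x` is realised on a dense subgroup by the values of
elements of `A_p(G)` with a norm bound, then it is realised everywhere with the same bound. -/
theorem exists_apply_eq_of_dense {X : Type*} [NormedAddCommGroup X] [NormedSpace ℂ X]
    {D : AddSubgroup X} (hD : Dense (D : Set X)) (ℓ : G → X →L[ℂ] ℂ) {C : ℝ}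
    (h : ∀ f ∈ D, ∃ a : HerzAlgebra μ p q, (∀ x, a x = ℓ x f) ∧ ‖a‖ ≤ C * ‖f‖) (f : X) :
    ∃ a : HerzAlgebra μ p q, (∀ x, a x = ℓ x f) ∧ ‖a‖ ≤ C * ‖f‖ := by
  obtain ⟨F, hFD, hF⟩ := mem_closure_iff_seq_limit.1 (hD f)
  choose a ha ha' using fun n => h (F n) (hFD n)
  -- An element of A_p(G) is determined by its values, so `a m - a n` is the element attached to `F
  -- m - F n`. This is why D has to be a subgroup.
  have hsub : ∀ m n, ‖a m - a n‖ ≤ C * ‖F m - F n‖ := fun m n => by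
    obtain ⟨b, hb, hb'⟩ := h _ (D.sub_mem (hFD m) (hFD n))
    convert hb' using 2
    exact DFunLike.ext _ _ fun x => by rw [sub_apply, hb, ha, ha, map_sub]
  have hC : CauchySeq a := by
    rw [cauchySeq_iff_tendsto_dist_atTop_0]
    have h0 := (cauchySeq_iff_tendsto_dist_atTop_0.1 hF.cauchySeq).const_mul C
    rw [mul_zero] at h0
    refine squeeze_zero (fun _ => dist_nonneg) (fun n => ?_) h0
    rw [dist_eq_norm, dist_eq_norm]
    exact hsub _ _
  obtain ⟨b, hb⟩ := cauchySeq_tendsto_of_complete hC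
  refine ⟨b, fun x => ?_, le_of_tendsto_of_tendsto' hb.norm (hF.norm.const_mul C) ha'⟩
  have h1 := ((eval μ p q x).continuous.tendsto b).comp hb
  refine tendsto_nhds_unique h1 ((((ℓ x).continuous.tendsto f).comp hF).congr fun n => ?_)
  exact (ha n x).symm

end HerzAlgebra

end HerzMult

/-! ### Multiplication by h * h^∨ on A_p(G) -/

namespace HerzMult

open Filter Topology
open scoped Pointwise

/-- A jointly continuous family of functions supported in a common compact set depends
continuously on the parameter, as a map into `L^p`. -/
theorem continuous_toLp_of_compact_support {X Y : Type*} [TopologicalSpace X] [TopologicalSpace Y]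
    [T2Space X] [MeasurableSpace X] [BorelSpace X] {ν : Measure X} [IsFiniteMeasureOnCompacts ν]
    {p : ℝ≥0∞} [Fact (1 ≤ p)] (hp : p ≠ ∞) {F : Y → X → ℂ} (hF : Continuous (Function.uncurry F))
    {K : Set X} (hK : IsCompact K) (hFK : ∀ r, ∀ s ∉ K, F r s = 0) (hm : ∀ r, MemLp (F r) p ν) :
    Continuous fun r => (hm r).toLp (F r) := by
  have hp0 : 0 < p.toReal :=
    ENNReal.toReal_pos (zero_lt_one.trans_le Fact.out).ne' hp
  refine continuous_iff_continuousAt.2 fun r₀ => ?_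
  refine EMetric.tendsto_nhds.2 fun ε hε => ?_
  obtain ⟨c, hc, hcε⟩ : ∃ c : ℝ, 0 < c ∧ ENNReal.ofReal c * ν K ^ (1 / p.toReal) < ε := by
    have hM : ν K ^ (1 / p.toReal) ≠ ∞ :=
      ENNReal.rpow_ne_top_of_nonneg (by positivity) hK.measure_lt_top.ne
    have h1 : Tendsto (fun c : ℝ => ENNReal.ofReal c * ν K ^ (1 / p.toReal)) (𝓝[>] 0) (𝓝 0) := by
      have h2 := ENNReal.Tendsto.mul_const
        (ENNReal.tendsto_ofReal (tendsto_id (x := 𝓝 (0 : ℝ)))) (Or.inr hM)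
      simp only [id, ENNReal.ofReal_zero, zero_mul] at h2
      exact h2.mono_left nhdsWithin_le_nhds
    obtain ⟨c, h3, h4⟩ := ((h1.eventually (gt_mem_nhds hε)).and self_mem_nhdsWithin).exists
    exact ⟨c, h4, h3⟩
  -- Compactness of K upgrades joint continuity to convergence of `F r` to `F r₀` uniformly on K.
  -- Since everything vanishes off K, a uniform error c costs at most c ν(K)^(1/p).
  obtain ⟨v, hv, hvc⟩ := hK.mem_uniformity_of_prod (s := Set.univ) hF.continuousOn
    (Set.mem_univ r₀) (Metric.dist_mem_uniformity hc)
  rw [nhdsWithin_univ] at hv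
  filter_upwards [hv] with r hr
  rw [Lp.edist_toLp_toLp]
  refine lt_of_le_of_lt (eLpNorm_sub_le_of_dist_bdd ν hp hK.measurableSet hc.le (fun s => ?_)
    ?_ ?_) hcε
  · by_cases hs : s ∈ K
    · exact (hvc r hr s hs).le
    · simp [hFK _ s hs, hc.le]
  · exact Function.support_subset_iff'.2 fun s hs => hFK r s hs
  · exact Function.support_subset_iff'.2 fun s hs => hFK r₀ s hs

theorem norm_toLp_rpow {X : Type*} [MeasurableSpace X] {ν : Measure X} {p : ℝ≥0∞} (hp0 : p ≠ 0)
    (hp : p ≠ ∞) {f : X → ℂ} (hf : MemLp f p ν) :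
    ‖hf.toLp f‖ ^ p.toReal = ∫ x, ‖f x‖ ^ p.toReal ∂ν := by
  have h0 : 0 ≤ ∫ x, ‖f x‖ ^ p.toReal ∂ν := integral_nonneg fun x => by positivity
  rw [Lp.norm_toLp, hf.eLpNorm_eq_integral_rpow_norm hp0 hp,
    ENNReal.toReal_ofReal (by positivity), ← Real.rpow_mul h0,
    inv_mul_cancel₀ (ENNReal.toReal_pos hp0 hp).ne', Real.rpow_one]

variable {G : Type*} [Group G] [TopologicalSpace G] [IsTopologicalGroup G]
  [LocallyCompactSpace G] [T2Space G] [MeasurableSpace G] [BorelSpace G]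
  {μ : Measure G} {p q : ℝ≥0∞} [μ.IsHaarMeasure] [p.HolderConjugate q]

/-- The function `s ↦ f(s) h(sr)`. -/
def slice (f h : G → ℂ) (r s : G) : ℂ := f s * h (s * r)

theorem continuous_slice {f h : G → ℂ} (hf : Continuous f) (hh : Continuous h) :
    Continuous (Function.uncurry (slice f h)) := by
  unfold slice Function.uncurry
  fun_prop

theorem slice_eq_zero_left {f h : G → ℂ} (r : G) {s : G} (hs : s ∉ tsupport f) :
    slice f h r s = 0 := by
  rw [slice, image_eq_zero_of_notMem_tsupport hs, zero_mul]

theorem slice_eq_zero_right {f h : G → ℂ} {r : G} (hr : r ∉ (tsupport f)⁻¹ * tsupport h) (s : G) :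
    slice f h r s = 0 := by
  by_cases hs : s ∈ tsupport f
  · rw [slice, image_eq_zero_of_notMem_tsupport (f := h), mul_zero]
    refine fun hsr => hr ?_
    simpa using Set.mul_mem_mul (Set.inv_mem_inv.2 hs) hsr
  · exact slice_eq_zero_left r hs

theorem hasCompactSupport_slice {f h : G → ℂ} (hf : HasCompactSupport f)
    (hh : HasCompactSupport h) : HasCompactSupport (Function.uncurry (slice f h)) := by
  refine HasCompactSupport.intro ((hf.isCompact.inv.mul hh.isCompact).prod hf.isCompact) ?_
  rintro ⟨r, s⟩ hrs
  by_cases hs : s ∈ tsupport f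
  · exact slice_eq_zero_right (fun hr => hrs ⟨hr, hs⟩) s
  · exact slice_eq_zero_left r hs

theorem memLp_slice {f h : G → ℂ} (hf : Continuous f) (hf' : HasCompactSupport f)
    (hh : Continuous h) (r : G) : MemLp (slice f h r) p μ := by
  refine Continuous.memLp_of_hasCompactSupport ?_ ?_
  · unfold slice; fun_prop
  · exact HasCompactSupport.intro hf'.isCompact fun s hs => slice_eq_zero_left r hs

variable (μ) in
-- For fixed s, the function r ↦ h(sr) is a left translate of h, so its integral over r does not
-- depend on s and the double integral splits. Compact support makes Fubini available without
-- σ-finiteness of μ.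
theorem integral_integral_slice_rpow {f h : G → ℂ} (hf : Continuous f) (hf' : HasCompactSupport f)
    (hh : Continuous h) (hh' : HasCompactSupport h) {t : ℝ} (ht : 0 < t) :
    ∫ r, ∫ s, ‖slice f h r s‖ ^ t ∂μ ∂μ = (∫ s, ‖f s‖ ^ t ∂μ) * ∫ s, ‖h s‖ ^ t ∂μ := by
  rw [integral_integral_swap_of_hasCompactSupport (f := fun r s => ‖slice f h r s‖ ^ t)]
  · rw [← integral_mul_const]
    congr 1 with s
    simp_rw [slice, norm_mul, Real.mul_rpow (norm_nonneg _) (norm_nonneg _)]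
    rw [integral_const_mul, integral_mul_left_eq_self (fun r => ‖h r‖ ^ t) s]
  · exact (continuous_slice hf hh).norm.rpow_const fun _ => Or.inr ht.le
  · exact (hasCompactSupport_slice hf' hh').comp_left (g := fun z : ℂ => ‖z‖ ^ t)
      (by simp [ht.ne'])

variable (μ) in
/-- For `u = g * f^∨` and `v = h * h^∨`, Fubini's theorem and left invariance express `uv` as an
integral over `r` of `G_r * F_r^∨`, where `F_r(s) = f(s) h(sr)` and `G_r(s) = g(s) h(sr)`. -/
theorem integral_integral_slice_mul_slice {f g h : G → ℂ} (hf : Continuous f) (hg : Continuous g)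
    (hg' : HasCompactSupport g) (hh : Continuous h) (hh' : HasCompactSupport h) (x : G) :
    ∫ r, ∫ s, slice g h r s * slice f h r (x⁻¹ * s) ∂μ ∂μ =
      conv μ h (check h) x * conv μ g (check f) x := by
  rw [integral_integral_swap_of_hasCompactSupport
    (f := fun r s => slice g h r s * slice f h r (x⁻¹ * s))]
  · rw [conv_check, conv_check, ← integral_const_mul]
    congr 1 with s
    rw [← integral_mul_left_eq_self (fun y => h y * h (x⁻¹ * y)) s, ← integral_mul_const]
    congr 1 with r
    simp only [slice, mul_assoc]
    ring
  · unfold slice Function.uncurry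
    fun_prop
  · exact (hasCompactSupport_slice hg' hh').mul_right
      (f' := fun z : G × G => slice f h z.1 (x⁻¹ * z.2))

namespace HerzAlgebra

/-- The element is the Bochner integral over r of H_r * F_r^∨, where F_r and H_r are the slices of f
and g. Evaluations are bounded, hence commute with the integral and identify its values. The norm is
at most ∫ ‖F_r‖_p ‖H_r‖_q dr, and Hölder in r together with `integral_integral_slice_rpow` gives the
constant. -/
theorem exists_apply_eq_of_hasCompactSupport (hp : p ≠ ∞) (hq : q ≠ ∞) {f g h : G → ℂ}
    (hf : Continuous f) (hf' : HasCompactSupport f) (hg : Continuous g) (hg' : HasCompactSupport g)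
    (hh : Continuous h) (hh' : HasCompactSupport h) (hfp : MemLp f p μ) (hgq : MemLp g q μ)
    (hhp : MemLp h p μ) (hhq : MemLp h q μ) :
    ∃ a : HerzAlgebra μ p q, (∀ x, a x = conv μ h (check h) x * conv μ g (check f) x) ∧
      ‖a‖ ≤ ‖hhp.toLp h‖ * ‖hhq.toLp h‖ * (‖hfp.toLp f‖ * ‖hgq.toLp g‖) := by
  have : Fact (1 ≤ p) := ⟨ENNReal.HolderConjugate.one_le p q⟩
  have : Fact (1 ≤ q) := ⟨ENNReal.HolderConjugate.one_le q p⟩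
  have hp0 : p ≠ 0 := (ENNReal.HolderConjugate.pos p q).ne'
  have hq0 : q ≠ 0 := (ENNReal.HolderConjugate.pos q p).ne'
  have hP : 0 < p.toReal := ENNReal.toReal_pos hp0 hp
  have hQ : 0 < q.toReal := ENNReal.toReal_pos hq0 hq
  have hPQ : p.toReal.HolderConjugate q.toReal := ENNReal.HolderConjugate.toReal_of_ne_top hp hq
  let F : G → Lp ℂ p μ := fun r => (memLp_slice hf hf' hh r).toLp (slice f h r)
  let H : G → Lp ℂ q μ := fun r => (memLp_slice hg hg' hh r).toLp (slice g h r)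
  have hF : Continuous F := continuous_toLp_of_compact_support hp (continuous_slice hf hh)
    hf'.isCompact (fun r _ hs => slice_eq_zero_left r hs) _
  have hH : Continuous H := continuous_toLp_of_compact_support hq (continuous_slice hg hh)
    hg'.isCompact (fun r _ hs => slice_eq_zero_left r hs) _
  have hF0 : ∀ r, r ∉ (tsupport f)⁻¹ * tsupport h → F r = 0 := fun r hr => by
    rw [Lp.eq_zero_iff_ae_eq_zero]
    refine (MemLp.coeFn_toLp _).trans (.of_forall fun s => slice_eq_zero_right hr s)
  have hH0 : ∀ r, r ∉ (tsupport g)⁻¹ * tsupport h → H r = 0 := fun r hr => by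
    rw [Lp.eq_zero_iff_ae_eq_zero]
    refine (MemLp.coeFn_toLp _).trans (.of_forall fun s => slice_eq_zero_right hr s)
  have hFc : HasCompactSupport F :=
    HasCompactSupport.intro (hf'.isCompact.inv.mul hh'.isCompact) hF0
  have hHc : HasCompactSupport H :=
    HasCompactSupport.intro (hg'.isCompact.inv.mul hh'.isCompact) hH0
  let U : G → HerzAlgebra μ p q := fun r => singleBilin μ p q (F r) (H r)
  have hU : Continuous U := ((singleBilin μ p q).continuous.comp hF).clm_apply hH
  have hUc : HasCompactSupport U := by
    refine HasCompactSupport.intro (hf'.isCompact.inv.mul hh'.isCompact) fun r hr => ?_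
    simp only [U, hF0 r hr, map_zero, _root_.zero_apply]
  have hUi : Integrable U μ := hU.integrable_of_hasCompactSupport hUc
  refine ⟨∫ r, U r ∂μ, fun x => ?_, ?_⟩
  · rw [← integral_integral_slice_mul_slice μ hf hg hg' hh hh' x, ← eval_apply,
      ← (eval μ p q x).integral_comp_comm hUi]
    congr 1 with r
    rw [eval_apply]
    change single (F r) (H r) x = _
    rw [single_apply]
    refine integral_congr_ae ?_
    filter_upwards [(memLp_slice hg hg' hh r).coeFn_toLp (p := q) (μ := μ),
      (measurePreserving_mul_left μ x⁻¹).quasiMeasurePreserving.ae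
        ((memLp_slice hf hf' hh r).coeFn_toLp (p := p) (μ := μ))] with y h1 h2
    rw [h1, h2]
  · have hFn : (∫ r, ‖F r‖ ^ p.toReal ∂μ) ^ (1 / p.toReal) = ‖hfp.toLp f‖ * ‖hhp.toLp h‖ := by
      have h1 : ∀ r, ‖F r‖ ^ p.toReal = ∫ s, ‖slice f h r s‖ ^ p.toReal ∂μ := fun r =>
        norm_toLp_rpow hp0 hp _
      simp_rw [h1]
      rw [integral_integral_slice_rpow μ hf hf' hh hh' hP, ← norm_toLp_rpow hp0 hp hfp,
        ← norm_toLp_rpow hp0 hp hhp, ← Real.mul_rpow (norm_nonneg _) (norm_nonneg _), one_div,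
        Real.rpow_rpow_inv (by positivity) hP.ne']
    have hHn : (∫ r, ‖H r‖ ^ q.toReal ∂μ) ^ (1 / q.toReal) = ‖hgq.toLp g‖ * ‖hhq.toLp h‖ := by
      have h1 : ∀ r, ‖H r‖ ^ q.toReal = ∫ s, ‖slice g h r s‖ ^ q.toReal ∂μ := fun r =>
        norm_toLp_rpow hq0 hq _
      simp_rw [h1]
      rw [integral_integral_slice_rpow μ hg hg' hh hh' hQ, ← norm_toLp_rpow hq0 hq hgq,
        ← norm_toLp_rpow hq0 hq hhq, ← Real.mul_rpow (norm_nonneg _) (norm_nonneg _), one_div,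
        Real.rpow_rpow_inv (by positivity) hQ.ne']
    calc ‖∫ r, U r ∂μ‖ ≤ ∫ r, ‖F r‖ * ‖H r‖ ∂μ :=
          norm_integral_le_of_norm_le
            ((hF.norm.mul hH.norm).integrable_of_hasCompactSupport hFc.norm.mul_right)
            (.of_forall fun r => norm_single_le _ _)
      _ ≤ (∫ r, ‖F r‖ ^ p.toReal ∂μ) ^ (1 / p.toReal) *
            (∫ r, ‖H r‖ ^ q.toReal ∂μ) ^ (1 / q.toReal) :=
          integral_mul_le_Lp_mul_Lq_of_nonneg hPQ (.of_forall fun r => norm_nonneg _)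
            (.of_forall fun r => norm_nonneg _)
            (hF.norm.memLp_of_hasCompactSupport hFc.norm)
            (hH.norm.memLp_of_hasCompactSupport hHc.norm)
      _ = ‖hhp.toLp h‖ * ‖hhq.toLp h‖ * (‖hfp.toLp f‖ * ‖hgq.toLp g‖) := by
          rw [hFn, hHn]; ring

/-- Multiplication by `h * h^∨`, for `h` continuous with compact support, maps the functions
`g * f^∨` to elements of `A_p(G)`, boundedly. -/
theorem exists_apply_eq [μ.Regular] (hp : p ≠ ∞) (hq : q ≠ ∞) {h : G → ℂ} (hh : Continuous h)
    (hh' : HasCompactSupport h) :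
    ∃ C : ℝ, ∀ (f : Lp ℂ p μ) (g : Lp ℂ q μ), ∃ a : HerzAlgebra μ p q,
      (∀ x, a x = conv μ h (check h) x * conv μ g (check f) x) ∧ ‖a‖ ≤ C * (‖f‖ * ‖g‖) := by
  have : Fact (1 ≤ p) := ⟨ENNReal.HolderConjugate.one_le p q⟩
  have : Fact (1 ≤ q) := ⟨ENNReal.HolderConjugate.one_le q p⟩
  have hhp : MemLp h p μ := hh.memLp_of_hasCompactSupport hh'
  have hhq : MemLp h q μ := hh.memLp_of_hasCompactSupport hh'
  let C := ‖hhp.toLp h‖ * ‖hhq.toLp h‖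
  have key : ∀ f ∈ compactlySupportedLp μ p, ∀ g ∈ compactlySupportedLp μ q,
      ∃ a : HerzAlgebra μ p q,
      (∀ x, a x = conv μ h (check h) x * single f g x) ∧ ‖a‖ ≤ C * (‖f‖ * ‖g‖) := by
    rintro φ ⟨f, hf, hf', hφ⟩ ψ ⟨g, hg, hg', hψ⟩
    have hfp : MemLp f p μ := hf.memLp_of_hasCompactSupport hf'
    have hgq : MemLp g q μ := hg.memLp_of_hasCompactSupport hg'
    have hφ' : φ = hfp.toLp f := Lp.ext (hφ.trans hfp.coeFn_toLp.symm)
    have hψ' : ψ = hgq.toLp g := Lp.ext (hψ.trans hgq.coeFn_toLp.symm)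
    obtain ⟨a, ha, ha'⟩ :=
      exists_apply_eq_of_hasCompactSupport hp hq hf hf' hg hg' hh hh' hfp hgq hhp hhq
    refine ⟨a, fun x => ?_, by rw [hφ', hψ']; exact ha'⟩
    rw [ha, single_apply, conv_check μ g]
    congr 1
    refine integral_congr_ae ?_
    filter_upwards [hψ, (measurePreserving_mul_left μ x⁻¹).quasiMeasurePreserving.ae hφ]
      with y h1 h2
    rw [h1, h2]
  refine ⟨C, fun f g => ?_⟩
  -- Density is used in one variable at a time: here g is fixed and f becomes arbitrary. The bound
  -- stays linear in ‖g‖, so the same extension then applies in g.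
  have step : ∀ g ∈ compactlySupportedLp μ q, ∃ a : HerzAlgebra μ p q,
      (∀ x, a x = conv μ h (check h) x * single f g x) ∧ ‖a‖ ≤ C * ‖f‖ * ‖g‖ := fun g hg => by
    obtain ⟨a, ha, ha'⟩ := exists_apply_eq_of_dense (dense_compactlySupportedLp μ hp)
      (fun x => conv μ h (check h) x • (eval μ p q x).comp ((singleBilin μ p q).flip g))
      (C := C * ‖g‖) (fun f hf => by
        obtain ⟨a, ha, ha'⟩ := key f hf g hg
        exact ⟨a, ha, ha'.trans_eq (by ring)⟩) f
    exact ⟨a, ha, ha'.trans_eq (by ring)⟩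
  obtain ⟨a, ha, ha'⟩ := exists_apply_eq_of_dense (dense_compactlySupportedLp μ hq)
    (fun x => conv μ h (check h) x • (eval μ p q x).comp (singleBilin μ p q f)) step g
  exact ⟨a, ha, ha'.trans_eq (by ring)⟩

end HerzAlgebra

/-- For `h` continuous with compact support, `h * h^∨` multiplies `A_p(G)` into itself. -/
theorem conv_check_self_mul_mem [μ.Regular] (hp : p ≠ ∞) (hq : q ≠ ∞) {h : G → ℂ}
    (hh : Continuous h) (hh' : HasCompactSupport h) {w : G → ℂ} (hw : w ∈ herzSubmodule μ p q) :
    conv μ h (check h) * w ∈ herzSubmodule μ p q := by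
  obtain ⟨f, g, hs, hfg⟩ := hw
  obtain ⟨C, hC⟩ := HerzAlgebra.exists_apply_eq hp hq hh hh' (μ := μ) (p := p) (q := q)
  choose a ha ha' using fun i => hC (f i) (g i)
  -- The infimum defining the norm need not be attained, so each term receives a summable slack
  -- (1/2)^i.
  let c : ℕ → ℝ := fun i => C * (‖f i‖ * ‖g i‖) + (1 / 2) ^ i
  have hc : Summable c := (hs.mul_left C).add summable_geometric_two
  have hrep : ∀ i, HasRep μ p q (a i) (c i) := fun i =>
    (a i).hasRep <| (ha' i).trans_lt <| by
      simp only [c]; linarith [show (0 : ℝ) < (1 / 2) ^ i by positivity]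
  obtain ⟨f', g', h', -⟩ := HasRep.sum hrep hc (U := conv μ h (check h) * w) fun x => by
    simp_rw [ha]
    exact (hfg x).mul_left _
  exact ⟨f', g', h'⟩

end HerzMult

/-! ### Separation of points by B_p(G), and invariant means lying in B_p(G) -/

namespace HerzMult

variable {G : Type*} [Group G] [TopologicalSpace G] [IsTopologicalGroup G]
  [LocallyCompactSpace G] [T2Space G] [MeasurableSpace G] [BorelSpace G]
  {μ : Measure G} {p q : ℝ≥0∞} [μ.IsHaarMeasure] [p.HolderConjugate q]

variable (μ) in
theorem continuous_conv_check_self {h : G → ℂ} (hh : Continuous h) (hh' : HasCompactSupport h) :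
    Continuous (conv μ h (check h)) := by
  rw [← continuousOn_univ]
  refine continuousOn_integral_of_compact_support hh'.isCompact (Continuous.continuousOn ?_) ?_
  · unfold check Function.uncurry
    fun_prop
  · intro x y _ hy
    rw [image_eq_zero_of_notMem_tsupport hy, zero_mul]

variable (μ) in
theorem hasCompactSupport_conv_check_self {h : G → ℂ} (hh : HasCompactSupport h) :
    HasCompactSupport (conv μ h (check h)) := by
  refine HasCompactSupport.intro (hh.isCompact.mul hh.isCompact.inv) fun x hx => ?_
  rw [conv_check]
  refine integral_eq_zero_of_ae (.of_forall fun y => ?_)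
  change h y * h (x⁻¹ * y) = 0
  by_cases hy : y ∈ tsupport h
  · rw [image_eq_zero_of_notMem_tsupport (f := h) (x := x⁻¹ * y) fun hxy => hx ?_, mul_zero]
    simpa using Set.mul_mem_mul hy (Set.inv_mem_inv.2 hxy)
  · rw [image_eq_zero_of_notMem_tsupport hy, zero_mul]

namespace Multiplier

/-- The function `h * h^∨`, for `h` continuous with compact support, as an element of `B_p(G)`. -/
def ofHasCompactSupport [μ.Regular] (hp : p ≠ ∞) (hq : q ≠ ∞) {h : G → ℂ}
    (hh : Continuous h) (hh' : HasCompactSupport h) : Multiplier μ p q :=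
  ⟨conv μ h (check h), continuous_conv_check_self μ hh hh',
    (continuous_conv_check_self μ hh hh').bounded_above_of_compact_support
      (hasCompactSupport_conv_check_self μ hh'),
    fun _ hw => conv_check_self_mul_mem hp hq hh hh' hw⟩

theorem ofHasCompactSupport_apply [μ.Regular] (hp : p ≠ ∞) (hq : q ≠ ∞) {h : G → ℂ}
    (hh : Continuous h) (hh' : HasCompactSupport h) (x : G) :
    (ofHasCompactSupport hp hq hh hh' : Multiplier μ p q) x = ∫ y, h y * h (x⁻¹ * y) ∂μ :=
  conv_check μ h h x

variable (μ) in
/-- `B_p(G)` separates the identity from the other points of `G`. -/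
theorem exists_apply_one_ne [μ.Regular] (hp : p ≠ ∞) (hq : q ≠ ∞) {x : G} (hx : x ≠ 1) :
    ∃ v : Multiplier μ p q, v x ≠ v 1 := by
  obtain ⟨U, V, hU, hV, h1U, hxV, hUV⟩ := t2_separation hx.symm
  -- Take h equal to 1 at e and 0 off W = U ∩ x⁻¹V. If h(y)h(x⁻¹y) ≠ 0 then y lies in both U and V,
  -- which are disjoint. So h * h^∨ vanishes at x, while its value at e is ∫ h² > 0.
  have hW : IsOpen (U ∩ (fun y => x * y) ⁻¹' V) :=
    hU.inter (hV.preimage (continuous_const_mul x))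
  obtain ⟨h, hh1, hh0, hh, hh01⟩ := exists_continuous_one_zero_of_isCompact
    (isCompact_singleton (x := (1 : G))) hW.isClosed_compl
    (Set.disjoint_compl_right_iff_subset.2 (by simp [h1U, hxV]))
  have hc : Continuous fun y => (h y : ℂ) := Complex.continuous_ofReal.comp h.continuous
  have hc' : HasCompactSupport fun y => (h y : ℂ) :=
    hh.comp_left (g := ((↑) : ℝ → ℂ)) Complex.ofReal_zero
  refine ⟨ofHasCompactSupport hp hq hc hc', ?_⟩
  rw [ofHasCompactSupport_apply, ofHasCompactSupport_apply]
  have h0 : ∀ y, (h y : ℂ) * h (x⁻¹ * y) = 0 := fun y => by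
    by_contra hne
    have hy : y ∈ U := by
      by_contra hy
      exact hne (by simp [hh0 (show y ∈ (U ∩ (fun y => x * y) ⁻¹' V)ᶜ from fun h => hy h.1)])
    have hy' : y ∈ V := by
      by_contra hy'
      refine hne ?_
      rw [hh0 (show x⁻¹ * y ∈ (U ∩ (fun y => x * y) ⁻¹' V)ᶜ from
        fun h => hy' (by simpa using h.2))]
      simp
    exact Set.disjoint_left.1 hUV hy hy'
  have hpos : 0 < ∫ y, h y * h y ∂μ := by
    refine (h.continuous.mul h.continuous).integral_pos_of_hasCompactSupport_nonneg_nonzero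
      hh.mul_right (fun y => mul_self_nonneg _) (x := 1) ?_
    simp [hh1 (Set.mem_singleton _)]
  simp_rw [h0, inv_one, one_mul, ← Complex.ofReal_mul]
  rw [integral_zero, integral_complex_ofReal]
  exact_mod_cast hpos.ne

/-- An element of `B_p(G)` is a topological invariant mean on `B_p(G)^*` if and only if it has norm
and value at `e` one, and every `v ∈ B_p(G)` acts on it as the scalar `v(e)`. -/
theorem inclusionInDoubleDual_mem_topInvMeans {u : Multiplier μ p q} :
    NormedSpace.inclusionInDoubleDual ℂ _ u ∈ topInvMeans μ p q ↔
      (‖u‖ = 1 ∧ u 1 = 1) ∧ ∀ v : Multiplier μ p q, v * u = v 1 • u := by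
  have hn : ‖NormedSpace.inclusionInDoubleDual ℂ _ u‖ = ‖u‖ :=
    (NormedSpace.inclusionInDoubleDualLi ℂ).norm_map u
  refine and_congr (and_congr (by rw [hn]) Iff.rfl) (forall_congr' fun v => ?_)
  -- Tested on φ, the bidual identity says φ(vu) = v(e)φ(u), and the functionals φ separate points.
  rw [SeparatingDual.eq_iff_forall_dual_eq (R := ℂ) (x := v * u), ContinuousLinearMap.ext_iff]
  refine forall_congr' fun φ => ?_
  rw [map_smul]
  rfl

/-- At x ≠ e the hypothesis gives v(x)u(x) = v(e)u(x), and a v with v(x) ≠ v(e) forces u(x) = 0. -/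
theorem eq_indicator_of_mul_eq [μ.Regular] (hp : p ≠ ∞) (hq : q ≠ ∞) {u : Multiplier μ p q}
    (h1 : u 1 = 1) (hu : ∀ v : Multiplier μ p q, v * u = v 1 • u) :
    (u : G → ℂ) = Set.indicator {1} 1 := by
  ext x
  by_cases hx : x = 1
  · simp [hx, h1]
  · obtain ⟨v, hv⟩ := exists_apply_one_ne μ hp hq hx
    have h := congrArg (fun w : Multiplier μ p q => w x) (hu v)
    simp only [mul_apply, smul_apply] at h
    simpa [hx, hv] using h

/-- Elements of B_p(G) are continuous, so {e}, the set where u ≠ 0, is open. -/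
theorem discreteTopology_of_eq_indicator {u : Multiplier μ p q}
    (hu : (u : G → ℂ) = Set.indicator {1} 1) : DiscreteTopology G := by
  refine discreteTopology_of_isOpen_singleton_one ?_
  have hc : Continuous (u : G → ℂ) := u.2.1
  convert! isOpen_ne.preimage hc (t := {z : ℂ | z ≠ 0}) using 1
  ext x
  by_cases hx : x = 1 <;> simp [hu, hx]

end Multiplier

/-! ### The indicator of the identity on a discrete group -/

variable (μ p q) in
-- With m = μ{e}, positive because {e} is open, χ_e = (m⁻¹χ_e) * χ_e^∨. The norms of the two factors
-- are m^(1/q - 1) and m^(1/p), whose product is 1.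
theorem hasRep_indicator_one [DiscreteTopology G] :
    HasRep μ p q (Set.indicator {1} 1 : G → ℂ) 1 := by
  have hs : MeasurableSet ({1} : Set G) := measurableSet_singleton 1
  have ht : μ {1} ≠ ∞ := isCompact_singleton.measure_lt_top.ne
  have h0 : μ {1} ≠ 0 := ((isOpen_discrete {(1 : G)}).measure_pos μ ⟨1, rfl⟩).ne'
  let m : ℝ := μ.real {1}
  have hm : 0 < m := ENNReal.toReal_pos h0 ht
  let f : Lp ℂ p μ := indicatorConstLp p hs ht 1
  let g : Lp ℂ q μ := indicatorConstLp q hs ht (m⁻¹ : ℂ)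
  have hpq : 1 / p.toReal + 1 / q.toReal = 1 := by
    have h := congrArg ENNReal.toReal (ENNReal.HolderConjugate.inv_add_inv_eq_one p q)
    rw [ENNReal.toReal_add (ENNReal.inv_ne_top.2 (ENNReal.HolderConjugate.pos p q).ne')
      (ENNReal.inv_ne_top.2 (ENNReal.HolderConjugate.pos q p).ne')] at h
    simpa using h
  have hc : ‖f‖ * ‖g‖ = 1 := by
    rw [norm_indicatorConstLp' (ENNReal.HolderConjugate.pos p q).ne' h0,
      norm_indicatorConstLp' (ENNReal.HolderConjugate.pos q p).ne' h0, norm_one, one_mul,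
      mul_left_comm, ← Real.rpow_add hm, hpq, Real.rpow_one, norm_inv, Complex.norm_real,
      Real.norm_of_nonneg hm.le, inv_mul_cancel₀ hm.ne']
  convert hc ▸ hasRep_single f g using 1
  ext x
  rw [conv_check]
  have h1 : (fun y => (g : G → ℂ) y * (f : G → ℂ) (x⁻¹ * y)) =ᵐ[μ]
      Set.indicator {1} fun _ => (m⁻¹ : ℂ) * Set.indicator {1} 1 x := by
    filter_upwards [indicatorConstLp_coeFn (p := q) (hs := hs) (hμs := ht) (c := (m⁻¹ : ℂ)),
      (measurePreserving_mul_left μ x⁻¹).quasiMeasurePreserving.ae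
        (indicatorConstLp_coeFn (p := p) (hs := hs) (hμs := ht) (c := (1 : ℂ)))] with y hy hy'
    rw [hy, hy']
    by_cases h : y = 1 <;> by_cases hx : x = 1 <;> simp [h, hx]
  rw [integral_congr_ae h1, integral_indicator hs, setIntegral_const, Complex.real_smul,
    mul_inv_cancel_left₀]
  exact_mod_cast hm.ne'

namespace Multiplier

variable (μ p q) in
/-- For discrete `G`, the indicator function of the identity, as an element of `B_p(G)`. -/
def indicatorOne [DiscreteTopology G] : Multiplier μ p q :=
  ⟨Set.indicator {1} 1, continuous_of_discreteTopology,
    ⟨1, fun x => (norm_indicator_le_norm_self _ _).trans (by simp)⟩, fun w _ => by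
      obtain ⟨f, g, h, -⟩ := hasRep_indicator_one μ p q
      have : Set.indicator {1} 1 * w = w 1 • (Set.indicator {1} 1 : G → ℂ) := by
        ext x
        by_cases hx : x = 1 <;> simp [hx]
      rw [this]
      exact Submodule.smul_mem _ _ ⟨f, g, h⟩⟩

variable (μ p q) in
theorem indicatorOne_apply [DiscreteTopology G] (x : G) :
    indicatorOne μ p q x = Set.indicator {1} 1 x := rfl

variable (μ p q) in
-- Multiplication by χ_e is the rank-one operator v ↦ v(e)χ_e, with |v(e)| ≤ ‖v‖ and χ_e of norm at
-- most 1 in A_p(G). The lower bound is the value at e.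
theorem norm_indicatorOne [DiscreteTopology G] : ‖indicatorOne μ p q‖ = 1 := by
  obtain ⟨f, g, h, hc⟩ := hasRep_indicator_one μ p q
  let w : HerzAlgebra μ p q := ⟨_, f, g, h⟩
  have hw : ‖w‖ ≤ 1 := HerzAlgebra.norm_le ⟨f, g, h, hc⟩
  refine le_antisymm ?_ ?_
  · rw [norm_eq]
    refine ContinuousLinearMap.opNorm_le_bound _ zero_le_one fun v => ?_
    have hv : mulCLM (indicatorOne μ p q) v = v 1 • w := DFunLike.ext _ _ fun x => by
      rw [HerzAlgebra.smul_apply]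
      change Set.indicator {1} 1 x * v x = v 1 * Set.indicator {1} 1 x
      by_cases hx : x = 1 <;> simp [hx]
    rw [hv, norm_smul, mul_comm]
    exact mul_le_mul hw (v.norm_apply_le 1) (norm_nonneg _) zero_le_one
  · simpa [indicatorOne_apply] using norm_apply_le (indicatorOne μ p q) 1

variable (μ p q) in
theorem indicatorOne_mem_topInvMeans [DiscreteTopology G] :
    NormedSpace.inclusionInDoubleDual ℂ _ (indicatorOne μ p q) ∈ topInvMeans μ p q := by
  refine inclusionInDoubleDual_mem_topInvMeans.2
    ⟨⟨norm_indicatorOne μ p q, by simp [indicatorOne_apply]⟩,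
      fun v => DFunLike.ext _ _ fun x => ?_⟩
  rw [mul_apply, smul_apply, indicatorOne_apply]
  by_cases hx : x = 1 <;> simp [hx]

end Multiplier

end HerzMult

end

/-! ### The proposition -/

theorem proposition3p3 {G : Type*} [Group G] [TopologicalSpace G] [IsTopologicalGroup G]
    [LocallyCompactSpace G] [T2Space G] [MeasurableSpace G] [BorelSpace G]
    (μ : Measure G) [μ.IsHaarMeasure] [μ.Regular]
    (p q : ℝ≥0∞) [p.HolderConjugate q] (hp : 1 < p) (hp' : p < ∞) :
    ((HerzMult.Multiplier.topInvMeans μ p q ∩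
        Set.range (NormedSpace.inclusionInDoubleDual ℂ (HerzMult.Multiplier μ p q))).Nonempty ↔
      DiscreteTopology G) ∧
    (DiscreteTopology G → ∃ χ : HerzMult.Multiplier μ p q,
      (χ : G → ℂ) = Set.indicator {1} 1 ∧
      {u : HerzMult.Multiplier μ p q | NormedSpace.inclusionInDoubleDual ℂ _ u ∈
        HerzMult.Multiplier.topInvMeans μ p q} = {χ}) := by
  -- If q = ∞ then p = 1. Finiteness of q is what density of C_c(G) in L^q requires.
  have hq : q ≠ ∞ := fun h => by
    have := ENNReal.HolderConjugate.inv_add_inv_eq_one p q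
    rw [h, ENNReal.inv_top, add_zero, ENNReal.inv_eq_one] at this
    exact hp.ne' this
  have hu : ∀ u : HerzMult.Multiplier μ p q, NormedSpace.inclusionInDoubleDual ℂ _ u ∈
      HerzMult.Multiplier.topInvMeans μ p q → (u : G → ℂ) = Set.indicator {1} 1 := fun u h => by
    obtain ⟨⟨-, h1⟩, h2⟩ := HerzMult.Multiplier.inclusionInDoubleDual_mem_topInvMeans.1 h
    exact HerzMult.Multiplier.eq_indicator_of_mul_eq hp'.ne hq h1 h2
  refine ⟨⟨?_, fun _ => ?_⟩, fun _ => ?_⟩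
  · rintro ⟨_, h, u, rfl⟩
    exact HerzMult.Multiplier.discreteTopology_of_eq_indicator (hu u h)
  · exact ⟨_, HerzMult.Multiplier.indicatorOne_mem_topInvMeans μ p q, _, rfl⟩
  · refine ⟨HerzMult.Multiplier.indicatorOne μ p q, rfl, Set.ext fun u => ⟨fun h => ?_, ?_⟩⟩
    · exact DFunLike.ext' (hu u h)
    · rintro rfl
      exact HerzMult.Multiplier.indicatorOne_mem_topInvMeans μ p q
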